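/- Let $n\ge 1$ be an integer, let $\alpha\ge 1$ be an integer, and let $C>0$, $\sigma>0$. Consider $n$ i.i.d. observations $(Y_i,X_i)\in\mathbb R\times[0,1]$ from the model $Y_i=f(X_i)+\xi_i$, with $X_i\sim U[0,1]$ and $\xi_i\sim N(0,\sigma^2)$ independent of $X_i$. The function $f$ belongs to the periodic Sobolev class $\tilde W(\alpha,C)$ of all $f:[0,1]\to\mathbb R$ that are $\alpha-1$ times continuously differentiable with $f^{(\alpha-1)}$ absolutely continuous, $f^{(j)}(0)=f^{(j)}(1)$ for $0\le j\le\alpha-1$, and $\int_0^1 (f^{(\alpha)}(x))^2\,dx\le C^2$. Let $\mathcal M_{\varepsilon,\delta}$ be the set of all $(\varepsilon,\delta)$-differentially private randomized estimators, that is, Markov kernels $\hat f$ from $(\mathbb R\times[0,1])^n$ to $L^2[0,1]$ (with its Borel $\sigma$-algebra) such that $$\mathbb P(\hat f(D)\in S)\le e^{\varepsilon}\,\mathbb P(\hat f(D')\in S)+\delta$$ for all data sets $D,D'$ that differ in at most one observation and all measurable $S$. Then there is a universal constant $c>0$ such that for all $\alpha,C,\sigma$ as above and every $a>0$ there is a constant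 $c'>0$, depending only on $\alpha,C,\sigma,a$, such that for all $n\ge1$, $0<\varepsilon<1$ and $0<\delta<c\,n^{-2}$ with $n\varepsilon\ge a$, $$\inf_{\hat f\in\mathcal M_{\varepsilon,\delta}}\ \sup_{f\in\tilde W(\alpha,C)}\ \mathbb E\left[\int_0^1\big(\hat f(x)-f(x)\big)^2\,dx\right]\ \ge\ c'\left(n^{-\frac{2\alpha}{2\alpha+1}}+(n\varepsilon)^{-\frac{2\alpha}{\alpha+1}}\right),$$ where the expectation is over the data and the randomness of $\hat f$, and takes values in $[0,\infty]$. -/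

import Mathlib

open MeasureTheory ProbabilityTheory Set
open scoped NNReal ENNReal

noncomputable section

namespace PrivateRegression

/-- The periodic Sobolev class of order `α ≥ 1` and radius `C` on `[0, 1]`: functions whose
derivative of order `α - 1` is absolutely continuous on `[0, 1]`, whose derivatives of orders
`0, …, α - 1` agree at the two endpoints, and whose derivative of order `α` (which exists almost
everywhere) is square integrable with `∫₀¹ (f^(α))² ≤ C²`. All derivatives are taken within
`[0, 1]`, so that the values of `f` outside `[0, 1]` play no role. -/
def periodicSobolev (α : ℕ) (C : ℝ) : Set (ℝ → ℝ) :=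
  {f | ContDiffOn ℝ ((α - 1 : ℕ) : WithTop ℕ∞) f (Icc 0 1) ∧
    AbsolutelyContinuousOnInterval (iteratedDerivWithin (α - 1) f (Icc 0 1)) 0 1 ∧
    (∀ j < α, iteratedDerivWithin j f (Icc 0 1) 0 = iteratedDerivWithin j f (Icc 0 1) 1) ∧
    MemLp (iteratedDerivWithin α f (Icc 0 1)) 2 (volume.restrict (Icc 0 1)) ∧
    ∫ x in (0 : ℝ)..1, (iteratedDerivWithin α f (Icc 0 1) x) ^ 2 ≤ C ^ 2}

/-- One observation `(Y, X)` with response `Y ∈ ℝ` and design point `X ∈ [0, 1]`. -/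
abbrev Datum : Type := ℝ × unitInterval

/-- An ordered data set of `n` observations. -/
abbrev Dataset (n : ℕ) : Type := Fin n → Datum

/-- The law of `(Y, X)` where `Y = f(X) + ξ`, `X ∼ U[0, 1]`, and `ξ ∼ N(0, σ²)` is independent
of `X`. -/
def datumLaw (f : ℝ → ℝ) (σ : ℝ≥0) : Measure Datum :=
  ((volume : Measure unitInterval).prod (gaussianReal 0 (σ ^ 2))).map
    (fun p => (f p.1 + p.2, p.1))

/-- The law of `n` independent observations. -/
def dataLaw (n : ℕ) (f : ℝ → ℝ) (σ : ℝ≥0) : Measure (Dataset n) :=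
  Measure.pi fun _ => datumLaw f σ

/-- The space `L²[0, 1]` of values of an estimator of the regression function. -/
abbrev L2Unit : Type := Lp ℝ 2 (volume : Measure unitInterval)

/-- `L²[0, 1]` carries its Borel σ-algebra. -/
instance instMeasurableSpaceL2Unit : MeasurableSpace L2Unit := borel L2Unit

instance instBorelSpaceL2Unit : BorelSpace L2Unit := ⟨rfl⟩

/-- Two data sets are adjacent if they differ in at most one observation, at the same position. -/
def Adjacent {n : ℕ} (D D' : Dataset n) : Prop :=
  ∃ i, ∀ j, j ≠ i → D j = D' j

/-- `(ε, δ)`-differential privacy of a randomized algorithm, which is a kernel that sends a data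
set to the law of the output given that data set. -/
def IsDP {n : ℕ} {R : Type*} [MeasurableSpace R] (ε δ : ℝ) (M : Kernel (Dataset n) R) : Prop :=
  ∀ D D' : Dataset n, Adjacent D D' → ∀ S : Set R, MeasurableSet S →
    M D S ≤ ENNReal.ofReal (Real.exp ε) * M D' S + ENNReal.ofReal δ

/-- The `(ε, δ)`-differentially private randomized estimators of the regression function. -/
def privateEstimators (n : ℕ) (ε δ : ℝ) : Set (Kernel (Dataset n) L2Unit) :=
  {M | IsMarkovKernel M ∧ IsDP ε δ M}

/-- The mean integrated squared error of the randomized estimator `M` at the regression function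
`f`, with values in `[0, ∞]`. The expectation is over the data and the randomness of `M`. -/
def mise {n : ℕ} (σ : ℝ≥0) (M : Kernel (Dataset n) L2Unit) (f : ℝ → ℝ) : ℝ≥0∞ :=
  ∫⁻ D, (∫⁻ g, (∫⁻ x : unitInterval, ENNReal.ofReal ((g x - f x) ^ 2)) ∂(M D)) ∂(dataLaw n f σ)

/-- The privacy-constrained minimax risk over the periodic Sobolev class. -/
def minimaxRisk (n α : ℕ) (C : ℝ) (σ : ℝ≥0) (ε δ : ℝ) : ℝ≥0∞ :=
  ⨅ M ∈ privateEstimators n ε δ, ⨆ f ∈ periodicSobolev α C, mise σ M f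

end PrivateRegression

end

namespace PrivateRegression

/-! ### Cauchy–Schwarz for real square-integrable functions -/

section CauchySchwarz

/-! The bound is proved by Assouad's method on a hypercube of bumps. Put `m` disjoint bumps of width
`1 / m` in `[0, 1]`, with coefficients in `{0, r}` and `r = L / m ^ α`; for small `L` every vertex
lies in the Sobolev class. The bumps are orthogonal in L², so by Bessel's inequality the loss
dominates a sum over coordinates, and each misjudged coordinate costs at least `r² / (16 m)`. If no
test separates two neighbouring vertices with advantage above `3/4`, then averaging over the cube
gives a vertex with risk at least `r² / 128` (`exists_vertex_le_mise`).

The advantage is bounded in two ways. Without privacy, the second moment of the likelihood ratio of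
one observation is at most `1 + 2 (r/σ)² / m` and tensorizes (`sq_integral_pi_le`), so it suffices
that `n ≤ m ^ (2α + 1)`. With privacy, the acceptance probability of a test changes by at most `K =
exp ε - 1 + δ` when one observation changes. Replacing the observations one at a time
(`integral_pi_sub_le`) then costs at most `n K · 2 (r/σ) / m`, so it suffices that `n ε ≤ m ^ (α +
1)`. The smallest admissible `m` gives the two rates, as `r²` is of order `m ^ (-2α)`. -/

theorem sq_integral_mul_le {X : Type*} [MeasurableSpace X] {μ : Measure X} {f g : X → ℝ}
    (hf : MemLp f 2 μ) (hg : MemLp g 2 μ) :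
    (∫ x, f x * g x ∂μ) ^ 2 ≤ (∫ x, f x ^ 2 ∂μ) * ∫ x, g x ^ 2 ∂μ := by
  have hfg : Integrable (fun x => f x * g x) μ := hf.integrable_mul hg
  have h : ∀ t : ℝ, 0 ≤ (∫ x, g x ^ 2 ∂μ) * (t * t) + (-2 * ∫ x, f x * g x ∂μ) * t
      + ∫ x, f x ^ 2 ∂μ := by
    intro t
    have e : ∫ x, (f x - t * g x) ^ 2 ∂μ = (∫ x, g x ^ 2 ∂μ) * (t * t)
        + (-2 * ∫ x, f x * g x ∂μ) * t + ∫ x, f x ^ 2 ∂μ := by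
      have : ∀ x, (f x - t * g x) ^ 2 = (t * t) * g x ^ 2 + (-2 * t) * (f x * g x) + f x ^ 2 :=
        fun x => by ring
      simp_rw [this]
      have h1 : Integrable (fun x => (t * t) * g x ^ 2) μ := hg.integrable_sq.const_mul _
      have h2 : Integrable (fun x => (-2 * t) * (f x * g x)) μ := hfg.const_mul _
      rw [integral_add (f := fun x => (t * t) * g x ^ 2 + (-2 * t) * (f x * g x)) (h1.add h2)
        hf.integrable_sq, integral_add h1 h2, integral_const_mul, integral_const_mul]
      ring
    rw [← e]
    exact integral_nonneg fun x => sq_nonneg _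
  have := discrim_le_zero h
  rw [discrim] at this
  nlinarith

end CauchySchwarz

/-! ### Comparing product measures one coordinate at a time -/

section Product

variable {X : Type*} [MeasurableSpace X]

theorem integrable_of_mem_unit {μ : Measure X} [IsFiniteMeasure μ] {u : X → ℝ}
    (hu : Measurable u) (hu01 : ∀ x, u x ∈ Icc (0 : ℝ) 1) : Integrable u μ :=
  Integrable.of_bound hu.aestronglyMeasurable 1 <| .of_forall fun x => by
    rw [Real.norm_of_nonneg (hu01 x).1]; exact (hu01 x).2

theorem integral_mem_unit {μ : Measure X} [IsProbabilityMeasure μ] {u : X → ℝ}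
    (hu : Measurable u) (hu01 : ∀ x, u x ∈ Icc (0 : ℝ) 1) : ∫ x, u x ∂μ ∈ Icc (0 : ℝ) 1 := by
  refine ⟨integral_nonneg fun x => (hu01 x).1, ?_⟩
  calc ∫ x, u x ∂μ ≤ ∫ _, (1 : ℝ) ∂μ :=
        integral_mono (integrable_of_mem_unit hu hu01) (integrable_const _) fun x => (hu01 x).2
    _ = 1 := by simp

theorem sq_mem_unit {t : ℝ} (ht : t ∈ Icc (0 : ℝ) 1) : t ^ 2 ∈ Icc (0 : ℝ) 1 :=
  ⟨sq_nonneg _, pow_le_one₀ ht.1 ht.2⟩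

theorem measurable_finCons {n : ℕ} :
    Measurable fun p : X × (Fin n → X) => (Fin.cons p.1 p.2 : Fin (n + 1) → X) := by
  refine measurable_pi_lambda _ fun i => ?_
  refine Fin.cases ?_ (fun j => ?_) i
  · simpa using measurable_fst
  · simp only [Fin.cons_succ]; fun_prop

theorem measurable_integral_cons {n : ℕ} {ν : Measure (Fin n → X)} [SFinite ν]
    {φ : (Fin (n + 1) → X) → ℝ} (hφ : Measurable φ) :
    Measurable fun x => ∫ D, φ (Fin.cons x D) ∂ν :=
  (StronglyMeasurable.integral_prod_right'
    (hφ.comp measurable_finCons).stronglyMeasurable).measurable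

theorem integral_pi_succ {P : Measure X} [IsProbabilityMeasure P] {n : ℕ}
    {φ : (Fin (n + 1) → X) → ℝ} (hφ : Measurable φ) (hφ01 : ∀ D, φ D ∈ Icc (0 : ℝ) 1) :
    ∫ D, φ D ∂Measure.pi (fun _ : Fin (n + 1) => P) =
      ∫ x, ∫ D, φ (Fin.cons x D) ∂Measure.pi (fun _ : Fin n => P) ∂P := by
  rw [← ((measurePreserving_piFinSuccAbove (fun _ : Fin (n + 1) => P) 0).symm).integral_comp']
  rw [integral_prod]
  · simp [MeasurableEquiv.piFinSuccAbove_symm_apply, Fin.insertNthEquiv]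
  · exact integrable_of_mem_unit (hφ.comp (MeasurableEquiv.measurable _)) fun p => hφ01 _

/-- Replacing the coordinates of a product measure one at a time. -/
theorem integral_pi_sub_le {P Q : Measure X} [IsProbabilityMeasure P] [IsProbabilityMeasure Q]
    {K τ : ℝ}
    (h : ∀ u : X → ℝ, Measurable u → (∀ x, u x ∈ Icc (0 : ℝ) 1) → (∀ x y, |u x - u y| ≤ K) →
      |∫ x, u x ∂P - ∫ x, u x ∂Q| ≤ K * τ)
    (n : ℕ) {φ : (Fin n → X) → ℝ} (hφ : Measurable φ) (hφ01 : ∀ D, φ D ∈ Icc (0 : ℝ) 1)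
    (hK : ∀ D D', (∃ i, ∀ j, j ≠ i → D j = D' j) → |φ D - φ D'| ≤ K) :
    |∫ D, φ D ∂Measure.pi (fun _ => P) - ∫ D, φ D ∂Measure.pi (fun _ => Q)| ≤ n * (K * τ) := by
  induction n with
  | zero =>
    have : Measure.pi (fun _ : Fin 0 => P) = Measure.pi (fun _ : Fin 0 => Q) := by
      congr 1; funext i; exact i.elim0
    simp [this]
  | succ n ih =>
    rw [integral_pi_succ hφ hφ01, integral_pi_succ hφ hφ01]
    have hm : ∀ x, Measurable fun D : Fin n → X => φ (Fin.cons x D) := fun x =>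
      hφ.comp (measurable_finCons.comp measurable_prodMk_left)
    set A : X → ℝ := fun x => ∫ D, φ (Fin.cons x D) ∂Measure.pi (fun _ : Fin n => P)
    set B : X → ℝ := fun x => ∫ D, φ (Fin.cons x D) ∂Measure.pi (fun _ : Fin n => Q)
    have hA : Measurable A := measurable_integral_cons hφ
    have hB : Measurable B := measurable_integral_cons hφ
    have hA01 : ∀ x, A x ∈ Icc (0 : ℝ) 1 := fun x => integral_mem_unit (hm x) fun _ => hφ01 _
    have hB01 : ∀ x, B x ∈ Icc (0 : ℝ) 1 := fun x => integral_mem_unit (hm x) fun _ => hφ01 _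
    -- Hybrid argument: first the last `n` coordinates pass from `P` to `Q`, uniformly in the value
    -- `x` of coordinate `0`.
    have h1 : |∫ x, A x ∂P - ∫ x, B x ∂P| ≤ n * (K * τ) := by
      rw [← integral_sub (integrable_of_mem_unit hA hA01) (integrable_of_mem_unit hB hB01)]
      have : ∀ x, |A x - B x| ≤ n * (K * τ) := fun x => ih (hm x) (fun _ => hφ01 _) <| by
        rintro D D' ⟨i, hi⟩
        refine hK _ _ ⟨i.succ, fun j hj => ?_⟩
        induction j using Fin.cases with
        | zero => rfl
        | succ j => simpa using hi j fun e => hj (e ▸ rfl)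
      simpa using norm_integral_le_of_norm_le_const (μ := P) (f := fun x => A x - B x)
        (.of_forall this)
    -- Then coordinate `0` changes. Averaging over the others preserves both the range `[0, 1]` and
    -- the oscillation bound `K`.
    have h2 : |∫ x, B x ∂P - ∫ x, B x ∂Q| ≤ K * τ := by
      refine h B hB hB01 fun x y => ?_
      change |(∫ D, φ (Fin.cons x D) ∂_) - ∫ D, φ (Fin.cons y D) ∂_| ≤ K
      rw [← integral_sub (integrable_of_mem_unit (hm x) fun _ => hφ01 _)
        (integrable_of_mem_unit (hm y) fun _ => hφ01 _)]
      have : ∀ D : Fin n → X, |φ (Fin.cons x D) - φ (Fin.cons y D)| ≤ K := fun D =>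
        hK _ _ ⟨0, fun j hj => by
          induction j using Fin.cases with
          | zero => exact absurd rfl hj
          | succ j => simp⟩
      simpa using norm_integral_le_of_norm_le_const
        (μ := Measure.pi (fun _ : Fin n => Q))
        (f := fun D => φ (Fin.cons x D) - φ (Fin.cons y D)) (.of_forall this)
    push_cast
    calc _ ≤ |∫ x, A x ∂P - ∫ x, B x ∂P| + |∫ x, B x ∂P - ∫ x, B x ∂Q| := abs_sub_le _ _ _
      _ ≤ _ := by linarith

/-- Tensorization of the second moment of the likelihood ratio. -/
theorem sq_integral_pi_le {P Q : Measure X} [IsProbabilityMeasure P] [IsProbabilityMeasure Q]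
    {ρ : ℝ} (hρ : 0 ≤ ρ)
    (h : ∀ u : X → ℝ, Measurable u → (∀ x, u x ∈ Icc (0 : ℝ) 1) →
      (∫ x, u x ∂P) ^ 2 ≤ ρ * ∫ x, u x ^ 2 ∂Q)
    (n : ℕ) {φ : (Fin n → X) → ℝ} (hφ : Measurable φ) (hφ01 : ∀ D, φ D ∈ Icc (0 : ℝ) 1) :
    (∫ D, φ D ∂Measure.pi (fun _ => P)) ^ 2 ≤
      ρ ^ n * ∫ D, φ D ^ 2 ∂Measure.pi (fun _ => Q) := by
  induction n with
  | zero =>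
    have e : ∀ D : Fin 0 → X, φ D = φ Fin.elim0 := fun D => congrArg φ (Subsingleton.elim _ _)
    simp [e]
  | succ n ih =>
    rw [integral_pi_succ hφ hφ01, integral_pi_succ (hφ.pow_const 2) fun D => sq_mem_unit (hφ01 D)]
    have hm : ∀ x, Measurable fun D : Fin n → X => φ (Fin.cons x D) := fun x =>
      hφ.comp (measurable_finCons.comp measurable_prodMk_left)
    set A : X → ℝ := fun x => ∫ D, φ (Fin.cons x D) ∂Measure.pi (fun _ : Fin n => P)
    have hA : Measurable A := measurable_integral_cons hφ
    have hA01 : ∀ x, A x ∈ Icc (0 : ℝ) 1 := fun x => integral_mem_unit (hm x) fun _ => hφ01 _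
    calc (∫ x, A x ∂P) ^ 2 ≤ ρ * ∫ x, A x ^ 2 ∂Q := h A hA hA01
      _ ≤ ρ * ∫ x, ρ ^ n * ∫ D, φ (Fin.cons x D) ^ 2 ∂Measure.pi (fun _ : Fin n => Q) ∂Q := by
        refine mul_le_mul_of_nonneg_left (integral_mono ?_ ?_ fun x => ih (hm x) fun _ => hφ01 _) hρ
        · exact integrable_of_mem_unit (hA.pow_const 2) fun x => sq_mem_unit (hA01 x)
        · refine Integrable.const_mul (integrable_of_mem_unit
            (measurable_integral_cons (hφ.pow_const 2)) fun x => ?_) _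
          exact integral_mem_unit ((hm x).pow_const 2) fun _ => sq_mem_unit (hφ01 _)
      _ = _ := by rw [integral_const_mul]; ring

end Product

/-! ### Gaussian shifts -/

section Gaussian

variable {v : ℝ≥0}

/-- The likelihood ratio of `N(d, v)` with respect to `N(0, v)`. -/
noncomputable def shiftRatio (v : ℝ≥0) (d z : ℝ) : ℝ := Real.exp (d / v * z - d ^ 2 / (2 * v))

/-- One-dimensional Cameron–Martin formula. No regularity of `u` is needed: the translation is a
measurable embedding and the densities are compared pointwise. -/
theorem integral_gaussian_shift (hv : v ≠ 0) (u : ℝ → ℝ) (a b : ℝ) :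
    ∫ z, u (a + z) ∂gaussianReal 0 v =
      ∫ z, u (b + z) * shiftRatio v (a - b) z ∂gaussianReal 0 v := by
  have h1 : ∫ z, u (a + z) ∂gaussianReal 0 v = ∫ z, u (b + z) ∂gaussianReal (a - b) v := by
    have := gaussianReal_map_const_add (μ := 0) (v := v) (a - b)
    rw [zero_add] at this
    rw [← this, (measurableEmbedding_addLeft (a - b)).integral_map]
    congr with z
    congr 1; ring
  have hv' : (v : ℝ) ≠ 0 := by exact_mod_cast hv
  rw [h1, integral_gaussianReal_eq_integral_smul hv, integral_gaussianReal_eq_integral_smul hv]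
  congr with z
  simp only [gaussianPDFReal, shiftRatio, smul_eq_mul]
  have : Real.exp (-(z - (a - b)) ^ 2 / (2 * v)) =
      Real.exp (-(z - 0) ^ 2 / (2 * v)) * Real.exp ((a - b) / v * z - (a - b) ^ 2 / (2 * v)) := by
    rw [← Real.exp_add]
    congr 1
    field_simp
    ring
  rw [this]
  ring

theorem shiftRatio_sq (hv : v ≠ 0) (d z : ℝ) :
    shiftRatio v d z ^ 2 = Real.exp (-(d ^ 2 / v)) * Real.exp (2 * d / v * z) := by
  have hv' : (v : ℝ) ≠ 0 := by exact_mod_cast hv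
  rw [shiftRatio, ← Real.exp_nat_mul, ← Real.exp_add]
  congr 1
  push_cast
  field_simp
  ring

theorem measurable_shiftRatio (v : ℝ≥0) (d : ℝ) : Measurable (shiftRatio v d) := by
  unfold shiftRatio; fun_prop

theorem memLp_shiftRatio (hv : v ≠ 0) (d : ℝ) :
    MemLp (shiftRatio v d) 2 (gaussianReal 0 v) := by
  rw [memLp_two_iff_integrable_sq (measurable_shiftRatio v d).aestronglyMeasurable]
  simp_rw [shiftRatio_sq hv]
  exact (integrable_exp_mul_gaussianReal _).const_mul _

theorem integral_exp_mul_gaussian (t : ℝ) :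
    ∫ z, Real.exp (t * z) ∂gaussianReal 0 v = Real.exp (v * t ^ 2 / 2) := by
  have := congrFun (mgf_id_gaussianReal (μ := 0) (v := v)) t
  simpa [mgf] using this

theorem integral_shiftRatio_sq (hv : v ≠ 0) (d : ℝ) :
    ∫ z, shiftRatio v d z ^ 2 ∂gaussianReal 0 v = Real.exp (d ^ 2 / v) := by
  have hv' : (v : ℝ) ≠ 0 := by exact_mod_cast hv
  simp_rw [shiftRatio_sq hv]
  rw [integral_const_mul, integral_exp_mul_gaussian, ← Real.exp_add]
  congr 1
  field_simp
  ring

theorem integral_shiftRatio (hv : v ≠ 0) (d : ℝ) :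
    ∫ z, shiftRatio v d z ∂gaussianReal 0 v = 1 := by
  simpa using (integral_gaussian_shift hv (fun _ => 1) d 0).symm

theorem memLp_of_mem_unit {X : Type*} [MeasurableSpace X] {μ : Measure X} [IsFiniteMeasure μ]
    {u : X → ℝ} (hu : Measurable u) (hu01 : ∀ x, u x ∈ Icc (0 : ℝ) 1) : MemLp u 2 μ :=
  MemLp.of_bound hu.aestronglyMeasurable 1 <| .of_forall fun x => by
    rw [Real.norm_of_nonneg (hu01 x).1]; exact (hu01 x).2

theorem sq_integral_gaussian_shift_le (hv : v ≠ 0) {u : ℝ → ℝ} (hu : Measurable u)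
    (hu01 : ∀ x, u x ∈ Icc (0 : ℝ) 1) (a b : ℝ) :
    (∫ z, u (a + z) ∂gaussianReal 0 v) ^ 2 ≤
      Real.exp ((a - b) ^ 2 / v) * ∫ z, u (b + z) ^ 2 ∂gaussianReal 0 v := by
  rw [integral_gaussian_shift hv u a b, mul_comm, ← integral_shiftRatio_sq hv]
  exact sq_integral_mul_le (memLp_of_mem_unit (by fun_prop) fun _ => hu01 _) (memLp_shiftRatio hv _)

/-- The likelihood ratio minus `1` has mean zero, so `u` may be recentred at `u b`. Cauchy–Schwarz
then involves only the oscillation `K`, which privacy makes small, and not the supremum of `u`. -/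
theorem abs_integral_gaussian_shift_sub_le (hv : v ≠ 0) {u : ℝ → ℝ} (hu : Measurable u)
    (hu01 : ∀ x, u x ∈ Icc (0 : ℝ) 1) {K : ℝ} (hK : ∀ x y, |u x - u y| ≤ K) (a b : ℝ) :
    |∫ z, u (a + z) ∂gaussianReal 0 v - ∫ z, u (b + z) ∂gaussianReal 0 v| ≤
      K * √(Real.exp ((a - b) ^ 2 / v) - 1) := by
  have hK0 : 0 ≤ K := (abs_nonneg _).trans (hK 0 0)
  set γ := gaussianReal 0 v
  set w := shiftRatio v (a - b)
  have hw := memLp_shiftRatio hv (a - b)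
  have hwi : Integrable w γ := hw.integrable one_le_two
  have hub : MemLp (fun z => u (b + z)) 2 γ := memLp_of_mem_unit (by fun_prop) fun _ => hu01 _
  have hubi : Integrable (fun z => u (b + z)) γ := hub.integrable one_le_two
  have hw1 : MemLp (fun z => w z - 1) 2 γ := hw.sub (memLp_const 1)
  have hubw : Integrable (fun z => u (b + z) * w z) γ := hub.integrable_mul hw
  have hubw1 : Integrable (fun z => u (b + z) * (w z - 1)) γ := hub.integrable_mul hw1
  have e : ∫ z, u (a + z) ∂γ - ∫ z, u (b + z) ∂γ = ∫ z, (u (b + z) - u b) * (w z - 1) ∂γ := by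
    have h3 : ∫ z, u b * (w z - 1) ∂γ = 0 := by
      rw [integral_const_mul, integral_sub hwi (integrable_const _), integral_shiftRatio hv]
      simp
    have h4 : ∫ z, u (b + z) * (w z - 1) ∂γ = ∫ z, u (a + z) ∂γ - ∫ z, u (b + z) ∂γ := by
      rw [integral_gaussian_shift hv u a b, ← integral_sub hubw hubi]
      congr with z
      ring
    simp_rw [sub_mul (u _)]
    rw [integral_sub hubw1 ((hw1.integrable one_le_two).const_mul _), h3, h4,
      sub_zero]
  have h5 : (∫ z, (u (b + z) - u b) * (w z - 1) ∂γ) ^ 2 ≤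
      K ^ 2 * (Real.exp ((a - b) ^ 2 / v) - 1) := by
    refine (sq_integral_mul_le (hub.sub (memLp_const (u b))) hw1).trans ?_
    refine mul_le_mul ?_ ?_ (integral_nonneg fun _ => sq_nonneg _) (sq_nonneg _)
    · calc _ ≤ ∫ _, K ^ 2 ∂γ := integral_mono (hub.sub (memLp_const (u b))).integrable_sq
            (integrable_const _) fun z => by
              simpa [sq_abs] using pow_le_pow_left₀ (abs_nonneg _) (hK (b + z) b) 2
        _ = K ^ 2 := by simp
    · apply le_of_eq
      have : ∀ z, (w z - 1) ^ 2 = w z ^ 2 - 2 * w z + 1 := fun z => by ring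
      simp_rw [this]
      have hw2 : Integrable (fun z => w z ^ 2) γ := hw.integrable_sq
      rw [integral_add (f := fun z => w z ^ 2 - 2 * w z) (hw2.sub (hwi.const_mul 2))
        (integrable_const _), integral_sub hw2 (hwi.const_mul 2), integral_const_mul,
        integral_shiftRatio hv, integral_shiftRatio_sq hv]
      simp
      ring
  rw [e, ← Real.sqrt_sq hK0, ← Real.sqrt_mul (sq_nonneg K)]
  exact Real.abs_le_sqrt h5

end Gaussian

/-! ### Comparing the laws of one observation -/

section DatumLaw

variable {σ : ℝ≥0} {f g : ℝ → ℝ}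

theorem measurable_observe (hf : Measurable f) :
    Measurable fun p : unitInterval × ℝ => ((f p.1 + p.2, p.1) : Datum) := by
  fun_prop

theorem isProbabilityMeasure_datumLaw (hf : Measurable f) :
    IsProbabilityMeasure (datumLaw f σ) :=
  Measure.isProbabilityMeasure_map (measurable_observe hf).aemeasurable

theorem integral_datumLaw (hf : Measurable f) {u : Datum → ℝ} (hu : Measurable u)
    (hu01 : ∀ x, u x ∈ Icc (0 : ℝ) 1) :
    ∫ p, u p ∂datumLaw f σ =
      ∫ x : unitInterval, ∫ z, u (f x + z, x) ∂gaussianReal 0 (σ ^ 2) := by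
  rw [datumLaw, integral_map (measurable_observe hf).aemeasurable hu.aestronglyMeasurable,
    integral_prod]
  exact integrable_of_mem_unit (hu.comp (measurable_observe hf)) fun _ => hu01 _

theorem measurable_integral_observe (hf : Measurable f) {u : Datum → ℝ} (hu : Measurable u) :
    Measurable fun x : unitInterval => ∫ z, u (f x + z, x) ∂gaussianReal 0 (σ ^ 2) :=
  (StronglyMeasurable.integral_prod_right'
    (hu.comp (measurable_observe hf)).stronglyMeasurable).measurable

/-- The design has the same law under `f` and `g`, so the Gaussian bound applies for each fixed `x`;
Cauchy–Schwarz in `x` combines the resulting `A ≤ √E √B`. -/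
theorem sq_integral_datumLaw_le (hσ : σ ≠ 0) (hf : Measurable f) (hg : Measurable g)
    (hd : Integrable fun x : unitInterval => Real.exp ((f x - g x) ^ 2 / (σ : ℝ) ^ 2))
    {u : Datum → ℝ} (hu : Measurable u) (hu01 : ∀ x, u x ∈ Icc (0 : ℝ) 1) :
    (∫ p, u p ∂datumLaw f σ) ^ 2 ≤
      (∫ x : unitInterval, Real.exp ((f x - g x) ^ 2 / (σ : ℝ) ^ 2)) *
        ∫ p, u p ^ 2 ∂datumLaw g σ := by
  rw [integral_datumLaw hf hu hu01,
    integral_datumLaw hg (hu.pow_const 2) fun _ => sq_mem_unit (hu01 _)]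
  set A : unitInterval → ℝ := fun x => ∫ z, u (f x + z, x) ∂gaussianReal 0 (σ ^ 2)
  set B : unitInterval → ℝ := fun x => ∫ z, u (g x + z, x) ^ 2 ∂gaussianReal 0 (σ ^ 2)
  set E : unitInterval → ℝ := fun x => Real.exp ((f x - g x) ^ 2 / (σ : ℝ) ^ 2)
  have hus : ∀ x : unitInterval, Measurable fun y => u (y, x) := fun x => by fun_prop
  have hAB : ∀ x, A x ^ 2 ≤ E x * B x := fun x => by
    simpa using sq_integral_gaussian_shift_le (v := σ ^ 2) (pow_ne_zero 2 hσ) (hus x)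
      (fun _ => hu01 _) (f x) (g x)
  have hA : Measurable A := measurable_integral_observe hf hu
  have hB : Measurable B := measurable_integral_observe hg (hu.pow_const 2)
  have hA01 : ∀ x, A x ∈ Icc (0 : ℝ) 1 := fun x =>
    integral_mem_unit ((hus x).comp (measurable_const_add (f x))) fun _ => hu01 _
  have hB01 : ∀ x, B x ∈ Icc (0 : ℝ) 1 := fun x =>
    integral_mem_unit (((hus x).comp (measurable_const_add (g x))).pow_const 2)
      fun _ => sq_mem_unit (hu01 _)
  have hE0 : ∀ x, 0 ≤ E x := fun x => (Real.exp_pos _).le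
  have hEm : Measurable E := by fun_prop
  have hsE : MemLp (fun x => √(E x)) 2 := by
    rw [memLp_two_iff_integrable_sq hEm.sqrt.aestronglyMeasurable]
    simpa only [Real.sq_sqrt (hE0 _)] using hd
  have hsB : MemLp (fun x => √(B x)) 2 := by
    rw [memLp_two_iff_integrable_sq hB.sqrt.aestronglyMeasurable]
    simpa only [Real.sq_sqrt (hB01 _).1] using integrable_of_mem_unit hB hB01
  have h := sq_integral_mul_le hsE hsB
  simp only [Real.sq_sqrt (hE0 _), Real.sq_sqrt (hB01 _).1] at h
  refine le_trans (pow_le_pow_left₀ (integral_mem_unit hA hA01).1 ?_ 2) h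
  refine integral_mono (integrable_of_mem_unit hA hA01) (hsE.integrable_mul hsB) fun x => ?_
  change A x ≤ √(E x) * √(B x)
  rw [← Real.sqrt_mul (hE0 x)]
  exact Real.le_sqrt_of_sq_le (hAB x)

/-- The pointwise bounds are averaged over `x` without Cauchy–Schwarz. For one bump the result
scales like `1 / m` instead of `1 / √m`, which is what yields the exponent `α + 1`. -/
theorem abs_integral_datumLaw_sub_le (hσ : σ ≠ 0) (hf : Measurable f) (hg : Measurable g)
    (hd : Integrable fun x : unitInterval => √(Real.exp ((f x - g x) ^ 2 / (σ : ℝ) ^ 2) - 1))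
    {u : Datum → ℝ} (hu : Measurable u) (hu01 : ∀ x, u x ∈ Icc (0 : ℝ) 1)
    {K : ℝ} (hK : ∀ x y, |u x - u y| ≤ K) :
    |∫ p, u p ∂datumLaw f σ - ∫ p, u p ∂datumLaw g σ| ≤
      K * ∫ x : unitInterval, √(Real.exp ((f x - g x) ^ 2 / (σ : ℝ) ^ 2) - 1) := by
  have hus : ∀ x : unitInterval, Measurable fun y => u (y, x) := fun x => by fun_prop
  have hi : ∀ {f : ℝ → ℝ}, Measurable f →
      Integrable fun x : unitInterval => ∫ z, u (f x + z, x) ∂gaussianReal 0 (σ ^ 2) :=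
    fun {f} hf => integrable_of_mem_unit (measurable_integral_observe hf hu) fun x =>
      integral_mem_unit ((hus x).comp (measurable_const_add (f x))) fun _ => hu01 _
  rw [integral_datumLaw hf hu hu01, integral_datumLaw hg hu hu01, ← integral_sub (hi hf) (hi hg),
    ← integral_const_mul]
  rw [← Real.norm_eq_abs]
  refine norm_integral_le_of_norm_le (hd.const_mul K) (.of_forall fun x => ?_)
  simpa using abs_integral_gaussian_shift_sub_le (v := σ ^ 2) (pow_ne_zero 2 hσ) (hus x)
      (fun _ => hu01 _) (fun _ _ => hK _ _) (f x) (g x)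

end DatumLaw

/-! ### Sums of bumps in the Sobolev class -/

section Bump

/-- A smooth bump function with support in `(0, 1)`. -/
noncomputable def unitBump : ContDiffBump (1 / 2 : ℝ) where
  rIn := 1 / 8
  rOut := 1 / 4
  rIn_pos := by norm_num
  rIn_lt_rOut := by norm_num

theorem contDiff_unitBump (n : WithTop ℕ∞) (hn : n ≤ ((⊤ : ℕ∞) : WithTop ℕ∞)) :
    ContDiff ℝ n unitBump :=
  unitBump.contDiff.of_le hn

theorem contDiff_nat_unitBump (k : ℕ) : ContDiff ℝ k unitBump :=
  contDiff_unitBump k (by exact_mod_cast le_top)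

/-- The support is in `[1/4, 3/4]`, so the bump vanishes near `0` and `1` too, and all its
derivatives are zero there. -/
theorem eventually_unitBump_eq_zero {x : ℝ} (hx : x ∉ Ioo (0 : ℝ) 1) :
    unitBump =ᶠ[nhds x] fun _ => 0 := by
  have hopen : IsOpen (Metric.closedBall (1 / 2 : ℝ) (1 / 4))ᶜ :=
    Metric.isClosed_closedBall.isOpen_compl
  have hmem : x ∈ (Metric.closedBall (1 / 2 : ℝ) (1 / 4))ᶜ := by
    rw [mem_compl_iff, Real.closedBall_eq_Icc]
    exact fun h => hx ⟨by linarith [h.1], by linarith [h.2]⟩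
  filter_upwards [hopen.mem_nhds hmem] with y hy
  refine unitBump.zero_of_le_dist ?_
  rw [mem_compl_iff, Metric.mem_closedBall, not_le] at hy
  exact hy.le

theorem iteratedDeriv_unitBump_eq_zero (k : ℕ) {x : ℝ} (hx : x ∉ Ioo (0 : ℝ) 1) :
    iteratedDeriv k unitBump x = 0 := by
  rw [(eventually_unitBump_eq_zero hx).iteratedDeriv_eq k, iteratedDeriv_const]
  simp

theorem unitBump_eq_zero {x : ℝ} (hx : x ∉ Ioo (0 : ℝ) 1) : unitBump x = 0 :=
  (eventually_unitBump_eq_zero hx).eq_of_nhds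

theorem unitBump_eq_one {x : ℝ} (hx : x ∈ Icc (3 / 8 : ℝ) (5 / 8)) : unitBump x = 1 := by
  refine unitBump.one_of_mem_closedBall ?_
  rw [Real.closedBall_eq_Icc]
  exact ⟨by norm_num [unitBump]; linarith [hx.1], by norm_num [unitBump]; linarith [hx.2]⟩

theorem exists_bound_iteratedDeriv_unitBump (k : ℕ) :
    ∃ B, 0 < B ∧ ∀ x, |iteratedDeriv k unitBump x| ≤ B := by
  have hc : Continuous (iteratedDeriv k unitBump) :=
    (contDiff_nat_unitBump k).continuous_iteratedDeriv' k
  obtain ⟨B, hB⟩ := isCompact_Icc.exists_bound_of_continuousOn (s := Icc (0 : ℝ) 1) hc.continuousOn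
  refine ⟨max B 1, by positivity, fun x => ?_⟩
  by_cases hx : x ∈ Ioo (0 : ℝ) 1
  · exact (hB x (Ioo_subset_Icc_self hx)).trans (le_max_left _ _)
  · rw [iteratedDeriv_unitBump_eq_zero k hx]; simp

variable {m : ℕ}

/-- The linear combination with coefficients `c` of `m` translated bumps of width `1 / m`. -/
noncomputable def bumpSum (c : Fin m → ℝ) (x : ℝ) : ℝ := ∑ j, c j * unitBump (m * x - j)

theorem index_eq_of_mem_Ioo {x : ℝ} {i j : Fin m} (hi : (m : ℝ) * x - i ∈ Ioo (0 : ℝ) 1)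
    (hj : (m : ℝ) * x - j ∈ Ioo (0 : ℝ) 1) : i = j := by
  have h1 : ((i : ℕ) : ℝ) < (j : ℕ) + 1 := by linarith [hi.1, hj.2]
  have h2 : ((j : ℕ) : ℝ) < (i : ℕ) + 1 := by linarith [hj.1, hi.2]
  have h1' : (i : ℕ) < j + 1 := by exact_mod_cast h1
  have h2' : (j : ℕ) < i + 1 := by exact_mod_cast h2
  exact Fin.ext (by omega)

theorem contDiff_bumpSum (c : Fin m → ℝ) (k : ℕ) : ContDiff ℝ k (bumpSum c) := by
  refine ContDiff.sum fun j _ => contDiff_const.mul ((contDiff_nat_unitBump k).comp ?_)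
  fun_prop

theorem continuous_bumpSum (c : Fin m → ℝ) : Continuous (bumpSum c) :=
  (contDiff_bumpSum c 0).continuous

theorem iteratedDeriv_bumpSum (c : Fin m → ℝ) (k : ℕ) (x : ℝ) :
    iteratedDeriv k (bumpSum c) x =
      ∑ j, c j * ((m : ℝ) ^ k * iteratedDeriv k unitBump (m * x - j)) := by
  have hcd : ∀ j : Fin m, ContDiff ℝ k fun x : ℝ => unitBump (m * x - j) := fun j =>
    (contDiff_nat_unitBump k).comp (by fun_prop)
  unfold bumpSum
  rw [iteratedDeriv_fun_sum fun j _ => (contDiff_const.mul (hcd j)).contDiffAt]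
  refine Finset.sum_congr rfl fun j _ => ?_
  rw [iteratedDeriv_const_mul _ (hcd j).contDiffAt]
  congr 1
  have h := congrFun (iteratedDeriv_comp_const_mul (n := k) (f := fun y => unitBump (y - j))
    ((contDiff_nat_unitBump k).comp (by fun_prop)) (m : ℝ)) x
  rw [h, iteratedDeriv_comp_sub_const]

/-- At most one term is nonzero at each `x`, so the number of bumps does not enter as a factor. -/
theorem abs_iteratedDeriv_bumpSum_le {c : Fin m → ℝ} {s B : ℝ} (hs : ∀ j, |c j| ≤ s) {k : ℕ}
    (hs0 : 0 ≤ s) (hB : ∀ x, |iteratedDeriv k unitBump x| ≤ B) (x : ℝ) :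
    |iteratedDeriv k (bumpSum c) x| ≤ s * (m ^ k * B) := by
  have hB0 : 0 ≤ B := (abs_nonneg _).trans (hB 0)
  rw [iteratedDeriv_bumpSum]
  by_cases h : ∃ i : Fin m, (m : ℝ) * x - i ∈ Ioo (0 : ℝ) 1
  · obtain ⟨i, hi⟩ := h
    rw [Finset.sum_eq_single i]
    · rw [abs_mul, abs_mul, abs_of_nonneg (by positivity : (0 : ℝ) ≤ (m : ℝ) ^ k)]
      exact mul_le_mul (hs i) (mul_le_mul_of_nonneg_left (hB _) (by positivity)) (by positivity) hs0
    · intro j _ hj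
      rw [iteratedDeriv_unitBump_eq_zero k fun h' => hj (index_eq_of_mem_Ioo h' hi)]
      simp
    · simp
  · push Not at h
    rw [Finset.sum_eq_zero fun j _ => by rw [iteratedDeriv_unitBump_eq_zero k (h j)]; simp]
    rw [abs_zero]; positivity

theorem bumpSum_mem_periodicSobolev {c : Fin m → ℝ} {s B C : ℝ} (hs : ∀ j, |c j| ≤ s) {α : ℕ}
    (hs0 : 0 ≤ s) (hB : ∀ x, |iteratedDeriv α unitBump x| ≤ B)
    (hC : s * (m ^ α * B) ≤ C) : bumpSum c ∈ periodicSobolev α C := by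
  have hw : ∀ k : ℕ, EqOn (iteratedDerivWithin k (bumpSum c) (Icc 0 1))
      (iteratedDeriv k (bumpSum c)) (Icc 0 1) := fun k x hx =>
    iteratedDerivWithin_eq_iteratedDeriv (uniqueDiffOn_Icc zero_lt_one)
      (contDiff_bumpSum c k).contDiffAt hx
  have hcont : ∀ k : ℕ, Continuous (iteratedDeriv k (bumpSum c)) := fun k =>
    (contDiff_bumpSum c k).continuous_iteratedDeriv' k
  have hbd := abs_iteratedDeriv_bumpSum_le hs hs0 hB
  have hC0 : 0 ≤ s * (m ^ α * B) := (abs_nonneg _).trans (hbd 0)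
  refine ⟨(contDiff_bumpSum c _).contDiffOn, ?_, ?_, ?_, ?_⟩
  · have h1 : ContDiffOn ℝ 1 (iteratedDerivWithin (α - 1) (bumpSum c) (Icc 0 1)) (uIcc 0 1) := by
      rw [uIcc_of_le zero_le_one]
      refine ContDiffOn.congr (ContDiff.contDiffOn ?_) (hw (α - 1))
      rw [iteratedDeriv_eq_iterate]
      exact_mod_cast ContDiff.iterate_deriv' 1 (α - 1) (contDiff_bumpSum c (1 + (α - 1)))
    exact h1.absolutelyContinuousOnInterval
  · intro j _
    rw [hw j (left_mem_Icc.2 zero_le_one), hw j (right_mem_Icc.2 zero_le_one),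
      iteratedDeriv_bumpSum, iteratedDeriv_bumpSum]
    refine Finset.sum_congr rfl fun i _ => ?_
    -- At the endpoints the rescaled arguments are `-i ≤ 0` and `m - i ≥ 1`, where every derivative
    -- of the bump vanishes.
    have hi : ((i : ℕ) : ℝ) + 1 ≤ m := by exact_mod_cast i.2
    have hi0 : (0 : ℝ) ≤ (i : ℕ) := Nat.cast_nonneg _
    rw [iteratedDeriv_unitBump_eq_zero j fun h => by linarith [h.1],
      iteratedDeriv_unitBump_eq_zero j fun h => by linarith [h.2]]
  · refine MemLp.of_bound (C := s * (m ^ α * B)) ?_ ?_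
    · refine (hcont α).aestronglyMeasurable.congr ?_
      filter_upwards [ae_restrict_mem measurableSet_Icc] with x hx using (hw α hx).symm
    · filter_upwards [ae_restrict_mem measurableSet_Icc] with x hx
      rw [hw α hx]; exact hbd x
  · have h1 : ∫ x in (0 : ℝ)..1, (iteratedDerivWithin α (bumpSum c) (Icc 0 1) x) ^ 2 =
        ∫ x in (0 : ℝ)..1, (iteratedDeriv α (bumpSum c) x) ^ 2 := by
      refine intervalIntegral.integral_congr fun x hx => ?_
      rw [uIcc_of_le zero_le_one] at hx
      simp only [hw α hx]
    rw [h1]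
    calc _ ≤ ∫ x in (0 : ℝ)..1, C ^ 2 := by
          refine intervalIntegral.integral_mono_on zero_le_one
            (((hcont α).pow 2).intervalIntegrable _ _) intervalIntegrable_const fun x _ => ?_
          rw [← sq_abs]
          exact pow_le_pow_left₀ (abs_nonneg _) ((hbd x).trans hC) 2
      _ = C ^ 2 := by simp

theorem bumpSum_sub_of_eq_off {c c' : Fin m → ℝ} {j : Fin m} (h : ∀ i, i ≠ j → c i = c' i) (x : ℝ) :
    bumpSum c x - bumpSum c' x = (c j - c' j) * unitBump (m * x - j) := by
  rw [bumpSum, bumpSum, ← Finset.sum_sub_distrib, Finset.sum_eq_single j]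
  · ring
  · intro i _ hi
    rw [h i hi, sub_self]
  · simp

end Bump

/-! ### Integrals over the support of one bump -/

section Cells

variable {m : ℕ}

/-- The points of the unit interval at which the `j`-th bump can be nonzero. -/
def cell (j : Fin m) : Set unitInterval := {x | (m : ℝ) * x - j ∈ Ioo (0 : ℝ) 1}

theorem measurableSet_cell (j : Fin m) : MeasurableSet (cell j) :=
  measurableSet_Ioo.preimage (by fun_prop)

theorem measureReal_cell_le (j : Fin m) :
    (volume : Measure unitInterval).real (cell j) ≤ 1 / m := by
  have hm : (0 : ℝ) < m := by exact_mod_cast j.pos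
  refine ENNReal.toReal_le_of_le_ofReal (by positivity) ?_
  rw [unitInterval.volume_apply]
  calc volume (Subtype.val '' cell j) ≤ volume (Ioo ((j : ℝ) / m) ((j + 1) / m)) := by
        refine measure_mono ?_
        rintro _ ⟨x, hx, rfl⟩
        rw [mem_Ioo, div_lt_iff₀ hm, lt_div_iff₀ hm]
        exact ⟨by linarith [hx.1], by linarith [hx.2]⟩
    _ = _ := by rw [Real.volume_Ioo]; congr 1; ring

/-- The bump equals `1` on the middle quarter of its cell. -/
theorem integral_unitBump_sq_ge (j : Fin m) :
    1 / (4 * m) ≤ ∫ x : unitInterval, unitBump (m * x - j) ^ 2 := by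
  have hm : (0 : ℝ) < m := by exact_mod_cast j.pos
  have hj : ((j : ℕ) : ℝ) + 1 ≤ m := by exact_mod_cast j.2
  have hj0 : (0 : ℝ) ≤ (j : ℕ) := Nat.cast_nonneg _
  set T : Set unitInterval := {x | (m : ℝ) * x - j ∈ Icc (3 / 8 : ℝ) (5 / 8)}
  have hT : MeasurableSet T := measurableSet_Icc.preimage (by fun_prop)
  have hvol : (volume : Measure unitInterval).real T = 1 / (4 * m) := by
    have : Subtype.val '' T = Icc (((j : ℝ) + 3 / 8) / m) ((j + 5 / 8) / m) := by
      ext x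
      rw [mem_Icc, div_le_iff₀ hm, le_div_iff₀ hm]
      constructor
      · rintro ⟨x, hx, rfl⟩
        exact ⟨by linarith [hx.1], by linarith [hx.2]⟩
      · rintro ⟨h1, h2⟩
        refine ⟨⟨x, ?_, ?_⟩, ⟨by simp only; linarith, by simp only; linarith⟩, rfl⟩
        · by_contra h; nlinarith
        · by_contra h; nlinarith
    rw [measureReal_def, unitInterval.volume_apply, this, Real.volume_Icc, ENNReal.toReal_ofReal]
    · field_simp; norm_num
    · rw [sub_nonneg]; gcongr; norm_num
  have hc : Continuous fun x : unitInterval => unitBump (m * x - j) ^ 2 :=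
    ((contDiff_nat_unitBump 0).continuous.comp (by fun_prop)).pow 2
  calc 1 / (4 * (m : ℝ)) = ∫ x : unitInterval, T.indicator (fun _ => (1 : ℝ)) x := by
        rw [integral_indicator_const _ hT, hvol]; simp
    _ ≤ _ := by
        refine integral_mono ((integrable_const _).indicator hT)
          (integrableOn_univ.1 (hc.continuousOn.integrableOn_compact isCompact_univ)) fun x => ?_
        by_cases hx : x ∈ T
        · simp [indicator_of_mem hx, unitBump_eq_one hx]
        · rw [indicator_of_notMem hx]; positivity

theorem continuous_bumpSum_coe (c : Fin m → ℝ) :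
    Continuous fun x : unitInterval => bumpSum c x :=
  (continuous_bumpSum c).comp continuous_subtype_val

theorem integrable_of_continuous {u : unitInterval → ℝ} (hu : Continuous u) : Integrable u :=
  integrableOn_univ.1 (hu.continuousOn.integrableOn_compact isCompact_univ)

theorem continuous_exp_bumpSum_sub (c c' : Fin m → ℝ) (σ : ℝ) : Continuous fun x : unitInterval =>
    Real.exp ((bumpSum c x - bumpSum c' x) ^ 2 / σ ^ 2) := by
  have := continuous_bumpSum_coe c
  have := continuous_bumpSum_coe c'
  fun_prop

theorem continuous_sqrt_exp_bumpSum_sub (c c' : Fin m → ℝ) (σ : ℝ) :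
    Continuous fun x : unitInterval =>
      √(Real.exp ((bumpSum c x - bumpSum c' x) ^ 2 / σ ^ 2) - 1) :=
  ((continuous_exp_bumpSum_sub c c' σ).sub continuous_const).sqrt

variable {σ r : ℝ} {c c' : Fin m → ℝ} {j : Fin m}

/-- Off the cell both functions agree. On it, `exp t - 1 ≤ 2 t` for `0 ≤ t ≤ 1`, and `r ≤ σ` keeps
the exponent in that range. -/
theorem exp_bumpSum_sub_le (hσ : 0 < σ) (hrσ : r ≤ σ) (hj : |c j - c' j| ≤ r)
    (h : ∀ i, i ≠ j → c i = c' i) (x : unitInterval) :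
    Real.exp ((bumpSum c x - bumpSum c' x) ^ 2 / σ ^ 2) - 1 ≤
      (cell j).indicator (fun _ => 2 * (r / σ) ^ 2) x := by
  rw [bumpSum_sub_of_eq_off h]
  by_cases hx : x ∈ cell j
  · rw [indicator_of_mem hx]
    have hr0 : 0 ≤ r := (abs_nonneg _).trans hj
    have hd : |(c j - c' j) * unitBump (m * x - j)| ≤ r := by
      rw [abs_mul, abs_of_nonneg unitBump.nonneg]
      exact (mul_le_of_le_one_right (abs_nonneg _) unitBump.le_one).trans hj
    set t := ((c j - c' j) * unitBump (m * x - j)) ^ 2 / σ ^ 2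
    have ht0 : 0 ≤ t := by positivity
    have ht : t ≤ (r / σ) ^ 2 := by
      rw [div_pow]
      refine div_le_div_of_nonneg_right ?_ (by positivity)
      rw [← sq_abs]
      exact pow_le_pow_left₀ (abs_nonneg _) hd 2
    have hr1 : (r / σ) ^ 2 ≤ 1 := pow_le_one₀ (by positivity) ((div_le_one hσ).2 hrσ)
    have := Real.abs_exp_sub_one_le (x := t) (by rw [abs_of_nonneg ht0]; exact ht.trans hr1)
    rw [abs_of_nonneg ht0] at this
    linarith [le_abs_self (Real.exp t - 1)]
  · rw [indicator_of_notMem hx, unitBump_eq_zero hx]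
    simp

theorem integral_exp_bumpSum_sub_le (hσ : 0 < σ) (hrσ : r ≤ σ) (hj : |c j - c' j| ≤ r)
    (h : ∀ i, i ≠ j → c i = c' i) :
    ∫ x : unitInterval, Real.exp ((bumpSum c x - bumpSum c' x) ^ 2 / σ ^ 2) ≤
      1 + 2 * (r / σ) ^ 2 / m := by
  have hi : Integrable ((cell j).indicator fun _ => 2 * (r / σ) ^ 2) :=
    (integrable_const _).indicator (measurableSet_cell j)
  calc _ ≤ ∫ x : unitInterval, 1 + (cell j).indicator (fun _ => 2 * (r / σ) ^ 2) x :=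
        integral_mono (integrable_of_continuous (continuous_exp_bumpSum_sub c c' σ))
          ((integrable_const _).add hi) fun x => by
          have := exp_bumpSum_sub_le hσ hrσ hj h x
          simp only
          linarith
    _ = 1 + (volume : Measure unitInterval).real (cell j) * (2 * (r / σ) ^ 2) := by
        rw [integral_add (integrable_const _) hi,
          integral_indicator_const _ (measurableSet_cell j)]
        simp
    _ ≤ 1 + 1 / m * (2 * (r / σ) ^ 2) := by
        have := measureReal_cell_le j
        gcongr
    _ = _ := by ring

theorem integral_sqrt_exp_bumpSum_sub_le (hσ : 0 < σ) (hrσ : r ≤ σ) (hj : |c j - c' j| ≤ r)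
    (h : ∀ i, i ≠ j → c i = c' i) :
    ∫ x : unitInterval, √(Real.exp ((bumpSum c x - bumpSum c' x) ^ 2 / σ ^ 2) - 1) ≤
      2 * (r / σ) / m := by
  have hr0 : 0 ≤ r := (abs_nonneg _).trans hj
  have hi : Integrable ((cell j).indicator fun _ => 2 * (r / σ)) :=
    (integrable_const _).indicator (measurableSet_cell j)
  calc _ ≤ ∫ x : unitInterval, (cell j).indicator (fun _ => 2 * (r / σ)) x :=
        integral_mono (integrable_of_continuous (continuous_sqrt_exp_bumpSum_sub c c' σ)) hi
          fun x => by
          have := exp_bumpSum_sub_le hσ hrσ hj h x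
          refine Real.sqrt_le_iff.2 ?_
          by_cases hx : x ∈ cell j
          · rw [indicator_of_mem hx] at this ⊢
            exact ⟨by positivity, this.trans (by nlinarith [sq_nonneg (r / σ)])⟩
          · rw [indicator_of_notMem hx] at this ⊢
            simpa using this
    _ = (volume : Measure unitInterval).real (cell j) * (2 * (r / σ)) := by
        rw [integral_indicator_const _ (measurableSet_cell j)]
        simp
    _ ≤ 1 / m * (2 * (r / σ)) := by
        have := measureReal_cell_le j
        gcongr
    _ = _ := by ring

end Cells

/-! ### Averaging over the hypercube -/

section Hypercube

/-- Flipping bit `j` permutes the vertices, so both terms of the hypothesis have the same average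
over the cube, which is therefore at least `κ / 2`. Some vertex is at least as good as the average
of the sum over `j`. -/
theorem exists_vertex_le_sum {m : ℕ} {q : (Fin m → Bool) → Fin m → ℝ} {κ : ℝ}
    (h : ∀ θ j, κ ≤ q θ j + q (Function.update θ j (!θ j)) j) :
    ∃ θ, m * κ / 2 ≤ ∑ j, q θ j := by
  have hflip : ∀ j : Fin m, Function.Involutive
      fun θ : Fin m → Bool => Function.update θ j (!θ j) := fun j θ => by simp
  have hj : ∀ j, ∑ _θ : Fin m → Bool, κ / 2 ≤ ∑ θ, q θ j := fun j => by
    have e : ∑ θ, q (Function.update θ j (!θ j)) j = ∑ θ, q θ j :=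
      Equiv.sum_comp ((hflip j).toPerm _) fun θ => q θ j
    have := Finset.sum_le_sum fun θ (_ : θ ∈ Finset.univ) => h θ j
    rw [Finset.sum_add_distrib, e] at this
    rw [← Finset.sum_div]
    linarith
  obtain ⟨θ, -, hθ⟩ := Finset.exists_le_of_sum_le
    (s := (Finset.univ : Finset (Fin m → Bool))) (f := fun _ => m * κ / 2)
    (g := fun θ => ∑ j, q θ j) Finset.univ_nonempty <| by
      rw [Finset.sum_comm]
      calc ∑ _θ : Fin m → Bool, m * κ / 2 = ∑ _j : Fin m, ∑ _θ : Fin m → Bool, κ / 2 := by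
            simp; ring
        _ ≤ _ := Finset.sum_le_sum fun j _ => hj j
  exact ⟨θ, hθ⟩

end Hypercube

/-! ### Orthogonality of the bumps in L² -/

section Projection

variable {m : ℕ}

theorem memLp_of_continuous {u : unitInterval → ℝ} (hu : Continuous u) : MemLp u 2 volume := by
  rw [memLp_two_iff_integrable_sq hu.aestronglyMeasurable]
  exact integrable_of_continuous (hu.pow 2)

theorem continuous_unitBump_coe (j : Fin m) :
    Continuous fun x : unitInterval => unitBump (m * x - j) :=
  (contDiff_nat_unitBump 0).continuous.comp (by fun_prop)

/-- The `j`-th bump as an element of `L²[0, 1]`. -/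
noncomputable def bumpLp (j : Fin m) : L2Unit :=
  (memLp_of_continuous (continuous_unitBump_coe j)).toLp

theorem coeFn_bumpLp (j : Fin m) : bumpLp j =ᵐ[volume] fun x => unitBump (m * x - j) :=
  MemLp.coeFn_toLp _

theorem inner_bumpLp (j : Fin m) (g : L2Unit) :
    inner ℝ (bumpLp j) g = ∫ x : unitInterval, unitBump (m * x - j) * g x := by
  rw [L2.inner_def]
  refine integral_congr_ae ?_
  filter_upwards [coeFn_bumpLp j] with x hx
  rw [hx]; simp [mul_comm]

theorem inner_bumpLp_self (j : Fin m) :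
    inner ℝ (bumpLp j) (bumpLp j) = ∫ x : unitInterval, unitBump (m * x - j) ^ 2 := by
  rw [inner_bumpLp]
  refine integral_congr_ae ?_
  filter_upwards [coeFn_bumpLp j] with x hx
  rw [hx, sq]

theorem inner_bumpLp_of_ne {i j : Fin m} (h : i ≠ j) : inner ℝ (bumpLp i) (bumpLp j) = 0 := by
  rw [inner_bumpLp]
  refine integral_eq_zero_of_ae ?_
  filter_upwards [coeFn_bumpLp j] with x hx
  rw [hx, Pi.zero_apply, mul_eq_zero, or_iff_not_imp_left]
  intro hi
  by_contra hj
  exact h (index_eq_of_mem_Ioo (not_imp_comm.1 unitBump_eq_zero hi)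
    (not_imp_comm.1 unitBump_eq_zero hj))

theorem norm_bumpLp_sq_ge (j : Fin m) : 1 / (4 * m) ≤ ‖bumpLp j‖ ^ 2 := by
  rw [← real_inner_self_eq_norm_sq, inner_bumpLp_self]
  exact integral_unitBump_sq_ge j

theorem norm_bumpLp_pos (j : Fin m) : 0 < ‖bumpLp j‖ := by
  have hm : (0 : ℝ) < m := by exact_mod_cast j.pos
  have h : 0 < ‖bumpLp j‖ ^ 2 := lt_of_lt_of_le (by positivity) (norm_bumpLp_sq_ge j)
  exact lt_of_le_of_ne (norm_nonneg _) fun e => by rw [← e] at h; norm_num at h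

theorem orthonormal_bumpLp :
    Orthonormal ℝ fun j : Fin m => (‖bumpLp j‖⁻¹ : ℝ) • bumpLp j := by
  refine ⟨fun j => ?_, fun i j h => ?_⟩
  · rw [norm_smul, norm_inv, norm_norm, inv_mul_cancel₀ (norm_bumpLp_pos j).ne']
  · simp only [real_inner_smul_left, real_inner_smul_right, inner_bumpLp_of_ne h, mul_zero]

theorem coeFn_sum_bumpLp (c : Fin m → ℝ) :
    (∑ j, c j • bumpLp j : L2Unit) =ᵐ[volume] fun x => bumpSum c x := by
  have h1 := Lp.coeFn_finsetSum Finset.univ fun j : Fin m => c j • bumpLp j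
  have h2 : ∀ᵐ x : unitInterval, ∀ j : Fin m, (c j • bumpLp j : L2Unit) x = c j * bumpLp j x :=
    ae_all_iff.2 fun j => by
      filter_upwards [Lp.coeFn_smul (c j) (bumpLp j)] with x hx
      rw [hx]; rfl
  have h3 : ∀ᵐ x : unitInterval, ∀ j : Fin m, bumpLp j x = unitBump (m * x - j) :=
    ae_all_iff.2 coeFn_bumpLp
  filter_upwards [h1, h2, h3] with x h1 h2 h3
  rw [h1, Finset.sum_apply, bumpSum]
  exact Finset.sum_congr rfl fun j _ => by rw [h2, h3]

theorem lintegral_sq_sub_bumpSum (g : L2Unit) (c : Fin m → ℝ) :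
    ∫⁻ x : unitInterval, ENNReal.ofReal ((g x - bumpSum c x) ^ 2) =
      ENNReal.ofReal (‖g - ∑ j, c j • bumpLp j‖ ^ 2) := by
  have hL : MemLp (fun x : unitInterval => g x - bumpSum c x) 2 volume :=
    (Lp.memLp g).sub (memLp_of_continuous (continuous_bumpSum_coe c))
  rw [← ofReal_integral_eq_lintegral_ofReal hL.integrable_sq (.of_forall fun x => sq_nonneg _),
    ← real_inner_self_eq_norm_sq, L2.inner_def]
  congr 1
  refine integral_congr_ae ?_
  filter_upwards [coeFn_sum_bumpLp c, Lp.coeFn_sub g (∑ j, c j • bumpLp j)] with x h1 h2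
  rw [h2, Pi.sub_apply, h1]
  simp [sq]

/-- Bessel's inequality for the normalized bumps. -/
theorem sum_sq_le_norm_sub_sq (g : L2Unit) (c : Fin m → ℝ) :
    ∑ j, (inner ℝ (bumpLp j) g - c j * ‖bumpLp j‖ ^ 2) ^ 2 / ‖bumpLp j‖ ^ 2 ≤
      ‖g - ∑ j, c j • bumpLp j‖ ^ 2 := by
  refine le_of_eq_of_le (Finset.sum_congr rfl fun j _ => ?_)
    (orthonormal_bumpLp.sum_inner_products_le (s := Finset.univ) (g - ∑ j, c j • bumpLp j))
  have : inner ℝ (bumpLp j) (∑ i, c i • bumpLp i) = c j * ‖bumpLp j‖ ^ 2 := by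
    rw [inner_sum, Finset.sum_eq_single j]
    · rw [real_inner_smul_right, real_inner_self_eq_norm_sq]
    · intro i _ hi
      rw [real_inner_smul_right, inner_bumpLp_of_ne hi.symm, mul_zero]
    · simp
  rw [real_inner_smul_left, inner_sub_right, this, Real.norm_eq_abs, sq_abs, mul_pow, inv_pow]
  ring

end Projection

/-! ### Reduction from estimation to testing -/

section Assouad

variable {m : ℕ} {r : ℝ}

/-- The coefficients in `{0, r}` attached to a vertex of the hypercube. -/
def vertexCoeff (r : ℝ) (θ : Fin m → Bool) (j : Fin m) : ℝ := if θ j then r else 0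

/-- The outputs whose projection on the `j`-th bump is closer to `r` than to `0`. -/
def detectSet (r : ℝ) (j : Fin m) : Set L2Unit :=
  {g | r * ‖bumpLp j‖ ^ 2 / 2 ≤ inner ℝ (bumpLp j) g}

theorem measurableSet_detectSet (j : Fin m) : MeasurableSet (detectSet r j) :=
  (isClosed_le continuous_const (by fun_prop)).measurableSet

/-- The outputs that misjudge the `j`-th coordinate when its value is `b`. -/
def errorSet (r : ℝ) (j : Fin m) (b : Bool) : Set L2Unit :=
  if b then (detectSet r j)ᶜ else detectSet r j

theorem measurableSet_errorSet (j : Fin m) (b : Bool) : MeasurableSet (errorSet r j b) := by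
  unfold errorSet
  split_ifs
  exacts [(measurableSet_detectSet j).compl, measurableSet_detectSet j]

/-- With `N = ‖bumpLp j‖ ^ 2`, a misjudged coordinate means that the projection is off by at least
`r N / 2`. Its Bessel term is then at least `r² N / 4`, and `N ≥ 1 / (4 m)`. -/
theorem sum_indicator_errorSet_le (hr : 0 ≤ r) (g : L2Unit) (θ : Fin m → Bool) :
    ∑ j, (errorSet r j (θ j)).indicator (fun _ => ENNReal.ofReal (r ^ 2 / (16 * m))) g ≤
      ∫⁻ x : unitInterval, ENNReal.ofReal ((g x - bumpSum (vertexCoeff r θ) x) ^ 2) := by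
  rw [lintegral_sq_sub_bumpSum]
  refine le_trans ?_ (ENNReal.ofReal_le_ofReal (sum_sq_le_norm_sub_sq g _))
  rw [ENNReal.ofReal_sum_of_nonneg fun j _ => by positivity]
  refine Finset.sum_le_sum fun j _ => ?_
  by_cases hg : g ∈ errorSet r j (θ j)
  · rw [indicator_of_mem hg]
    refine ENNReal.ofReal_le_ofReal ?_
    have hN : 0 < ‖bumpLp j‖ ^ 2 := pow_pos (norm_bumpLp_pos j) 2
    have hNm := norm_bumpLp_sq_ge j
    have hm : (0 : ℝ) < m := by exact_mod_cast j.pos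
    set N := ‖bumpLp j‖ ^ 2
    have key : (r * N / 2) ^ 2 ≤ (inner ℝ (bumpLp j) g - vertexCoeff r θ j * N) ^ 2 := by
      have h0 : 0 ≤ r * N / 2 := by positivity
      cases hb : θ j
      · simp only [errorSet, hb, Bool.false_eq_true, if_false, detectSet, mem_ofPred_eq] at hg
        simp only [vertexCoeff, hb, Bool.false_eq_true, if_false, zero_mul, sub_zero]
        exact pow_le_pow_left₀ h0 hg 2
      · simp only [errorSet, hb, if_true, detectSet, mem_compl_iff, mem_ofPred_eq, not_le] at hg
        simp only [vertexCoeff, hb, if_true]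
        rw [← neg_sq (_ - r * N)]
        exact pow_le_pow_left₀ h0 (by linarith) 2
    rw [le_div_iff₀ hN]
    calc r ^ 2 / (16 * m) * N = r ^ 2 / 4 * N * (1 / (4 * m)) := by field_simp; ring
      _ ≤ r ^ 2 / 4 * N * N := by gcongr
      _ = (r * N / 2) ^ 2 := by ring
      _ ≤ _ := key
  · rw [indicator_of_notMem hg]; exact zero_le

theorem lintegral_kernel_apply {n : ℕ} {P : Measure (Dataset n)} [IsProbabilityMeasure P]
    (M : Kernel (Dataset n) L2Unit) [IsMarkovKernel M] {S : Set L2Unit} (hS : MeasurableSet S) :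
    ∫⁻ D, M D S ∂P = ENNReal.ofReal (∫ D, (M D).real S ∂P) := by
  rw [ofReal_integral_eq_lintegral_ofReal]
  · simp
  · exact integrable_of_mem_unit (M.measurable_coe hS).ennreal_toReal
      fun D => ⟨measureReal_nonneg, measureReal_le_one⟩
  · exact .of_forall fun D => measureReal_nonneg

theorem isProbabilityMeasure_dataLaw (n : ℕ) {f : ℝ → ℝ} (hf : Measurable f) (σ : ℝ≥0) :
    IsProbabilityMeasure (dataLaw n f σ) := by
  have := isProbabilityMeasure_datumLaw (σ := σ) hf
  unfold dataLaw
  infer_instance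

theorem measurable_kernel_real {n : ℕ} (M : Kernel (Dataset n) L2Unit) {S : Set L2Unit}
    (hS : MeasurableSet S) : Measurable fun D => (M D).real S :=
  (M.measurable_coe hS).ennreal_toReal

theorem kernel_real_mem_unit {n : ℕ} (M : Kernel (Dataset n) L2Unit) [IsMarkovKernel M]
    (S : Set L2Unit) (D : Dataset n) : (M D).real S ∈ Icc (0 : ℝ) 1 :=
  ⟨measureReal_nonneg, measureReal_le_one⟩

theorem ofReal_sum_error_le_mise {n : ℕ} {σ : ℝ≥0} (M : Kernel (Dataset n) L2Unit)
    [IsMarkovKernel M] (hr : 0 ≤ r) (θ : Fin m → Bool) :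
    ENNReal.ofReal (r ^ 2 / (16 * m) * ∑ j, ∫ D, (M D).real (errorSet r j (θ j))
      ∂dataLaw n (bumpSum (vertexCoeff r θ)) σ) ≤ mise σ M (bumpSum (vertexCoeff r θ)) := by
  have := isProbabilityMeasure_dataLaw n (continuous_bumpSum (vertexCoeff r θ)).measurable σ
  set P := dataLaw n (bumpSum (vertexCoeff r θ)) σ
  set t := r ^ 2 / (16 * (m : ℝ))
  have hE : ∀ j, MeasurableSet (errorSet r j (θ j)) := fun j => measurableSet_errorSet j _
  calc _ = ∑ j, ENNReal.ofReal t * ∫⁻ D, M D (errorSet r j (θ j)) ∂P := by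
        rw [ENNReal.ofReal_mul (by positivity), ENNReal.ofReal_sum_of_nonneg fun j _ =>
          integral_nonneg fun D => measureReal_nonneg, Finset.mul_sum]
        exact Finset.sum_congr rfl fun j _ => by rw [lintegral_kernel_apply M (hE j)]
    _ = ∫⁻ D, ∑ j, ENNReal.ofReal t * M D (errorSet r j (θ j)) ∂P := by
        rw [lintegral_finsetSum _ fun j _ => (M.measurable_coe (hE j)).const_mul _]
        exact Finset.sum_congr rfl fun j _ =>
          (lintegral_const_mul _ (M.measurable_coe (hE j))).symm
    _ = ∫⁻ D, ∫⁻ g, ∑ j, (errorSet r j (θ j)).indicator (fun _ => ENNReal.ofReal t) g ∂M D ∂P := by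
        refine lintegral_congr fun D => ?_
        rw [lintegral_finsetSum _ fun j _ => measurable_const.indicator (hE j)]
        exact Finset.sum_congr rfl fun j _ => by rw [lintegral_indicator_const (hE j)]
    _ ≤ _ := lintegral_mono fun D => lintegral_mono fun g => sum_indicator_errorSet_le hr g θ

/-- Assouad's lemma for the hypercube of bumps. -/
theorem exists_vertex_le_mise {n : ℕ} {σ : ℝ≥0} (M : Kernel (Dataset n) L2Unit)
    [IsMarkovKernel M] (hm : 0 < m) (hr : 0 ≤ r)
    (h : ∀ (θ : Fin m → Bool) (j : Fin m),
      ∫ D, (M D).real (detectSet r j)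
          ∂dataLaw n (bumpSum (vertexCoeff r (Function.update θ j true))) σ -
        ∫ D, (M D).real (detectSet r j)
          ∂dataLaw n (bumpSum (vertexCoeff r (Function.update θ j false))) σ ≤ 3 / 4) :
    ∃ θ : Fin m → Bool, ENNReal.ofReal (r ^ 2 / 128) ≤ mise σ M (bumpSum (vertexCoeff r θ)) := by
  set q : (Fin m → Bool) → Fin m → ℝ := fun θ j =>
    ∫ D, (M D).real (errorSet r j (θ j)) ∂dataLaw n (bumpSum (vertexCoeff r θ)) σ
  -- The two error probabilities add up to one minus the advantage of the test.
  have hq : ∀ θ j, 1 / 4 ≤ q (Function.update θ j true) j + q (Function.update θ j false) j := by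
    intro θ j
    have := isProbabilityMeasure_dataLaw n
      (continuous_bumpSum (vertexCoeff r (Function.update θ j true))).measurable σ
    have h1 : q (Function.update θ j true) j = 1 - ∫ D, (M D).real (detectSet r j)
        ∂dataLaw n (bumpSum (vertexCoeff r (Function.update θ j true))) σ := by
      simp only [q, errorSet, Function.update_self, if_true,
        measureReal_compl (measurableSet_detectSet j), probReal_univ]
      rw [integral_sub (integrable_const _) (integrable_of_mem_unit
        (measurable_kernel_real M (measurableSet_detectSet j)) (kernel_real_mem_unit M _))]
      simp
    have h2 : q (Function.update θ j false) j = ∫ D, (M D).real (detectSet r j)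
        ∂dataLaw n (bumpSum (vertexCoeff r (Function.update θ j false))) σ := by
      simp [q, errorSet]
    rw [h1, h2]
    linarith [h θ j]
  obtain ⟨θ, hθ⟩ : ∃ θ, m * (1 / 4) / 2 ≤ ∑ j, q θ j := by
    clear_value q
    refine exists_vertex_le_sum fun θ j => ?_
    have h1 := hq θ j
    have h2 : Function.update θ j (θ j) = θ := Function.update_eq_self j θ
    cases hb : θ j
    · rw [hb] at h2
      rw [h2] at h1
      rw [Bool.not_false]
      linarith
    · rw [hb] at h2
      rw [h2] at h1
      rw [Bool.not_true]
      linarith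
  refine ⟨θ, le_trans (ENNReal.ofReal_le_ofReal ?_) (ofReal_sum_error_le_mise M hr θ)⟩
  have hm' : (0 : ℝ) < m := by exact_mod_cast hm
  -- The error probabilities at `θ` sum to at least `m / 8`, and each is weighted by `r² / (16 m)`.
  calc r ^ 2 / 128 = r ^ 2 / (16 * m) * (m * (1 / 4) / 2) := by field_simp; ring
    _ ≤ _ := by gcongr

theorem abs_vertexCoeff_le (hr : 0 ≤ r) (θ : Fin m → Bool) (j : Fin m) :
    |vertexCoeff r θ j| ≤ r := by
  unfold vertexCoeff
  split_ifs <;> simp [abs_of_nonneg, hr]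

theorem abs_vertexCoeff_update_sub_le (hr : 0 ≤ r) (θ : Fin m → Bool) (j : Fin m) (b b' : Bool) :
    |vertexCoeff r (Function.update θ j b) j - vertexCoeff r (Function.update θ j b') j| ≤ r := by
  cases b <;> cases b' <;> simp [vertexCoeff, abs_of_nonneg, hr]

theorem vertexCoeff_update_of_ne (θ : Fin m → Bool) (b b' : Bool) {i j : Fin m} (h : i ≠ j) :
    vertexCoeff r (Function.update θ j b) i = vertexCoeff r (Function.update θ j b') i := by
  simp [vertexCoeff, h]

end Assouad

/-! ### Indistinguishability of neighbouring vertices -/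

section LowerBounds

variable {n m : ℕ} {r : ℝ} {σ : ℝ≥0}

/-- Without privacy, neighbouring vertices cannot be told apart when `n r² / (σ² m)` is small. -/
theorem exists_vertex_le_mise_of_sample (M : Kernel (Dataset n) L2Unit) [IsMarkovKernel M]
    (hm : 0 < m) (hr : 0 ≤ r) (hσ : 0 < σ) (hrσ : r ≤ σ)
    (h : n * (2 * (r / σ) ^ 2 / m) ≤ 1) :
    ∃ θ : Fin m → Bool, ENNReal.ofReal (r ^ 2 / 128) ≤ mise σ M (bumpSum (vertexCoeff r θ)) := by
  refine exists_vertex_le_mise M hm hr fun θ j => ?_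
  set f := bumpSum (vertexCoeff r (Function.update θ j true))
  set g := bumpSum (vertexCoeff r (Function.update θ j false))
  set φ : Dataset n → ℝ := fun D => (M D).real (detectSet r j)
  have hf : Measurable f := (continuous_bumpSum _).measurable
  have hg : Measurable g := (continuous_bumpSum _).measurable
  have hσ' : (0 : ℝ) < σ := by exact_mod_cast hσ
  have := isProbabilityMeasure_datumLaw (σ := σ) hf
  have := isProbabilityMeasure_datumLaw (σ := σ) hg
  have hφ : Measurable φ := measurable_kernel_real M (measurableSet_detectSet j)
  have hφ01 : ∀ D, φ D ∈ Icc (0 : ℝ) 1 := kernel_real_mem_unit M _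
  have hE : Continuous fun x : unitInterval => Real.exp ((f x - g x) ^ 2 / (σ : ℝ) ^ 2) :=
    continuous_exp_bumpSum_sub _ _ _
  set ρ := ∫ x : unitInterval, Real.exp ((f x - g x) ^ 2 / (σ : ℝ) ^ 2)
  have hρ0 : 0 ≤ ρ := integral_nonneg fun x => (Real.exp_pos _).le
  have hρ : ρ ≤ 1 + 2 * (r / σ) ^ 2 / m :=
    integral_exp_bumpSum_sub_le hσ' hrσ (abs_vertexCoeff_update_sub_le hr θ j _ _)
      fun i hi => vertexCoeff_update_of_ne θ _ _ hi
  have hρn : ρ ^ n ≤ 4 := by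
    calc ρ ^ n ≤ Real.exp (2 * (r / σ) ^ 2 / m) ^ n := by
          gcongr
          exact hρ.trans (by rw [add_comm]; exact Real.add_one_le_exp _)
      _ = Real.exp (n * (2 * (r / σ) ^ 2 / m)) := (Real.exp_nat_mul _ _).symm
      _ ≤ Real.exp 1 := Real.exp_le_exp.2 h
      _ ≤ 4 := by linarith [Real.exp_one_lt_d9]
  have key := sq_integral_pi_le hρ0 (fun u hu hu01 => sq_integral_datumLaw_le hσ.ne' hf hg
    (integrable_of_continuous hE) hu hu01) n hφ hφ01
  change (∫ D, φ D ∂dataLaw n f σ) ^ 2 ≤ ρ ^ n * ∫ D, φ D ^ 2 ∂dataLaw n g σ at key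
  have := isProbabilityMeasure_dataLaw n hf σ
  have := isProbabilityMeasure_dataLaw n hg σ
  have h2 : ∫ D, φ D ^ 2 ∂dataLaw n g σ ≤ ∫ D, φ D ∂dataLaw n g σ :=
    integral_mono (integrable_of_mem_unit (hφ.pow_const 2) fun D => sq_mem_unit (hφ01 D))
      (integrable_of_mem_unit hφ hφ01) fun D => pow_le_of_le_one (hφ01 D).1 (hφ01 D).2 two_ne_zero
  have h3 := integral_mem_unit (μ := dataLaw n f σ) hφ hφ01
  have h4 := integral_mem_unit (μ := dataLaw n g σ) (hφ.pow_const 2) fun D => sq_mem_unit (hφ01 D)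
  have h5 : ρ ^ n * ∫ D, φ D ^ 2 ∂dataLaw n g σ ≤ 4 * ∫ D, φ D ^ 2 ∂dataLaw n g σ :=
    mul_le_mul_of_nonneg_right hρn h4.1
  -- If `p` and `q` are the acceptance probabilities, then `p² ≤ 4 q`, so `p - q ≤ p - p² / 4 ≤ 3/4`
  -- on `[0, 1]`; the last step is `(1 - p) (3 - p) ≥ 0`.
  nlinarith [h3.1, h3.2, sq_nonneg (1 - (∫ D, φ D ∂dataLaw n f σ))]

/-- The output probabilities of a private algorithm have small coordinate oscillation. -/
theorem IsDP.abs_sub_le {M : Kernel (Dataset n) L2Unit} [IsMarkovKernel M] {ε δ : ℝ} (hε : 0 ≤ ε)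
    (hδ : 0 ≤ δ) (hM : IsDP ε δ M) {S : Set L2Unit} (hS : MeasurableSet S) {D D' : Dataset n}
    (h : Adjacent D D') : |(M D).real S - (M D').real S| ≤ Real.exp ε - 1 + δ := by
  have key : ∀ D D' : Dataset n, Adjacent D D' →
      (M D).real S - (M D').real S ≤ Real.exp ε - 1 + δ := fun D D' h => by
    have h1 := ENNReal.toReal_mono (by finiteness) (hM D D' h S hS)
    rw [ENNReal.toReal_add (by finiteness) (by finiteness), ENNReal.toReal_mul,
      ENNReal.toReal_ofReal (Real.exp_pos _).le, ENNReal.toReal_ofReal hδ] at h1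
    change (M D).real S ≤ Real.exp ε * (M D').real S + δ at h1
    -- As `(M D').real S ≤ 1`, the multiplicative slack is at most `exp ε - 1`.
    have h2 := Real.one_le_exp hε
    have h3 := kernel_real_mem_unit M S D'
    nlinarith [h3.1, h3.2]
  obtain ⟨i, hi⟩ := h
  rw [abs_sub_le_iff]
  exact ⟨key _ _ ⟨i, hi⟩, key _ _ ⟨i, fun j hj => (hi j hj).symm⟩⟩

/-- Under privacy, neighbouring vertices cannot be told apart when `n ε r / (σ m)` is small. -/
theorem exists_vertex_le_mise_of_isDP (M : Kernel (Dataset n) L2Unit) [IsMarkovKernel M]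
    {ε δ : ℝ} (hε : 0 ≤ ε) (hδ : 0 ≤ δ) (hM : IsDP ε δ M)
    (hm : 0 < m) (hr : 0 ≤ r) (hσ : 0 < σ) (hrσ : r ≤ σ)
    (h : n * ((Real.exp ε - 1 + δ) * (2 * (r / σ) / m)) ≤ 3 / 4) :
    ∃ θ : Fin m → Bool, ENNReal.ofReal (r ^ 2 / 128) ≤ mise σ M (bumpSum (vertexCoeff r θ)) := by
  refine exists_vertex_le_mise M hm hr fun θ j => ?_
  set f := bumpSum (vertexCoeff r (Function.update θ j true))
  set g := bumpSum (vertexCoeff r (Function.update θ j false))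
  have hf : Measurable f := (continuous_bumpSum _).measurable
  have hg : Measurable g := (continuous_bumpSum _).measurable
  have hσ' : (0 : ℝ) < σ := by exact_mod_cast hσ
  have := isProbabilityMeasure_datumLaw (σ := σ) hf
  have := isProbabilityMeasure_datumLaw (σ := σ) hg
  have hE : Continuous fun x : unitInterval =>
      √(Real.exp ((f x - g x) ^ 2 / (σ : ℝ) ^ 2) - 1) := continuous_sqrt_exp_bumpSum_sub _ _ _
  have hτ := integral_sqrt_exp_bumpSum_sub_le hσ' hrσ
    (abs_vertexCoeff_update_sub_le hr θ j true false) fun i hi => vertexCoeff_update_of_ne θ _ _ hi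
  have hK0 : 0 ≤ Real.exp ε - 1 + δ := by linarith [Real.one_le_exp hε]
  refine (le_abs_self _).trans <| (integral_pi_sub_le (K := Real.exp ε - 1 + δ)
    (fun u hu hu01 hK => abs_integral_datumLaw_sub_le hσ.ne' hf hg (integrable_of_continuous hE)
      hu hu01 hK) n (measurable_kernel_real M (measurableSet_detectSet j))
      (kernel_real_mem_unit M _)
      fun D D' hD => hM.abs_sub_le hε hδ (measurableSet_detectSet j) hD).trans ?_
  exact le_trans (by gcongr) h

end LowerBounds

/-! ### Choice of the number of bumps -/

section Rates

/-- The number of bumps that balances bias and indistinguishability. -/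
theorem exists_width (p k : ℕ) (hp : 0 < p) {y₀ : ℝ} (hy₀ : 0 < y₀) :
    ∃ κ : ℝ, 0 < κ ∧ ∀ y : ℝ, y₀ ≤ y → ∃ m : ℕ, 0 < m ∧ y ≤ (m : ℝ) ^ p ∧
      κ * y ^ (-(k : ℝ) / p) ≤ ((m : ℝ) ^ k)⁻¹ := by
  have hp' : (p : ℝ) ≠ 0 := by exact_mod_cast hp.ne'
  set x₀ := y₀ ^ (1 / (p : ℝ))
  have hx₀ : 0 < x₀ := Real.rpow_pos_of_pos hy₀ _
  -- Rounding up costs at most this factor: `⌈x⌉ ≤ x + 1 ≤ K x` once `x ≥ x₀`.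
  set K := 1 + 1 / x₀
  have hK : 0 < K := by positivity
  refine ⟨(K ^ k)⁻¹, by positivity, fun y hy => ?_⟩
  have hy0 : 0 < y := hy₀.trans_le hy
  set x := y ^ (1 / (p : ℝ))
  have hx : 0 < x := Real.rpow_pos_of_pos hy0 _
  have hxx : x₀ ≤ x := Real.rpow_le_rpow hy₀.le hy (by positivity)
  have hm : 0 < ⌈x⌉₊ := Nat.ceil_pos.2 hx
  have hm' : (0 : ℝ) < ⌈x⌉₊ := by exact_mod_cast hm
  have hxp : x ^ p = y := by
    rw [← Real.rpow_natCast, ← Real.rpow_mul hy0.le, one_div_mul_cancel hp', Real.rpow_one]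
  have hxk : x ^ k = y ^ ((k : ℝ) / p) := by
    rw [← Real.rpow_natCast, ← Real.rpow_mul hy0.le]
    congr 1
    ring
  refine ⟨⌈x⌉₊, hm, ?_, ?_⟩
  · rw [← hxp]
    exact pow_le_pow_left₀ hx.le (Nat.le_ceil x) p
  · rw [neg_div, Real.rpow_neg hy0.le, ← hxk, ← mul_inv, ← mul_pow]
    refine inv_anti₀ (by positivity) (pow_le_pow_left₀ hm'.le ?_ k)
    have h1 : 1 ≤ 1 / x₀ * x := by rw [one_div, inv_mul_eq_div, one_le_div hx₀]; exact hxx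
    calc (⌈x⌉₊ : ℝ) ≤ x + 1 := (Nat.ceil_lt_add_one hx.le).le
      _ ≤ K * x := by simp only [K]; linarith

theorem exp_sub_one_le_two_mul {ε : ℝ} (h0 : 0 ≤ ε) (h1 : ε ≤ 1) : Real.exp ε - 1 ≤ 2 * ε := by
  have h := Real.abs_exp_sub_one_le (x := ε) (by rwa [abs_of_nonneg h0])
  rw [abs_of_nonneg h0] at h
  exact (le_abs_self _).trans h

variable {n m α : ℕ} {C L B : ℝ} {σ : ℝ≥0}

/-- The amplitude `L / m ^ α` cancels the factor `m ^ α` produced by `α` differentiations. -/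
theorem bumpSum_vertexCoeff_mem (hL : 0 ≤ L) (hm : 0 < m)
    (hB : ∀ x, |iteratedDeriv α unitBump x| ≤ B) (hC : L * B ≤ C) (θ : Fin m → Bool) :
    bumpSum (vertexCoeff (L / m ^ α) θ) ∈ periodicSobolev α C := by
  have hm' : (0 : ℝ) < m := by exact_mod_cast hm
  have hr : 0 ≤ L / (m : ℝ) ^ α := by positivity
  refine bumpSum_mem_periodicSobolev (abs_vertexCoeff_le hr θ) hr hB ?_
  rwa [← mul_assoc, div_mul_cancel₀ _ (by positivity)]

theorem le_iSup_mise_of_vertex (M : Kernel (Dataset n) L2Unit) (hL : 0 ≤ L) (hm : 0 < m)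
    (hB : ∀ x, |iteratedDeriv α unitBump x| ≤ B) (hC : L * B ≤ C)
    (h : ∃ θ : Fin m → Bool, ENNReal.ofReal ((L / (m : ℝ) ^ α) ^ 2 / 128) ≤
      mise σ M (bumpSum (vertexCoeff (L / m ^ α) θ))) :
    ENNReal.ofReal (L ^ 2 / 128 * ((m : ℝ) ^ (2 * α))⁻¹) ≤
      ⨆ f ∈ periodicSobolev α C, mise σ M f := by
  obtain ⟨θ, hθ⟩ := h
  refine le_iSup₂_of_le _ (bumpSum_vertexCoeff_mem hL hm hB hC θ) (le_of_eq_of_le ?_ hθ)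
  congr 1
  rw [div_pow, ← pow_mul, mul_comm α 2]
  ring

theorem amplitude_le (hL : 0 ≤ L) (hLσ : L ≤ σ) (hm : 0 < m) : L / (m : ℝ) ^ α ≤ σ := by
  have : (1 : ℝ) ≤ (m : ℝ) ^ α := one_le_pow₀ (by exact_mod_cast hm)
  exact (div_le_self hL this).trans hLσ

theorem sample_lower_bound (M : Kernel (Dataset n) L2Unit) [IsMarkovKernel M] (hσ : 0 < σ)
    (hL : 0 ≤ L) (hLσ : L ≤ σ / 2) (hm : 0 < m) (hn : (n : ℝ) ≤ (m : ℝ) ^ (2 * α + 1))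
    (hB : ∀ x, |iteratedDeriv α unitBump x| ≤ B) (hC : L * B ≤ C) :
    ENNReal.ofReal (L ^ 2 / 128 * ((m : ℝ) ^ (2 * α))⁻¹) ≤
      ⨆ f ∈ periodicSobolev α C, mise σ M f := by
  have hm' : (0 : ℝ) < m := by exact_mod_cast hm
  have hσ' : (0 : ℝ) < σ := by exact_mod_cast hσ
  refine le_iSup_mise_of_vertex M hL hm hB hC (exists_vertex_le_mise_of_sample M hm (by positivity)
    hσ (amplitude_le hL (by linarith) hm) ?_)
  have h1 : L / σ ≤ 1 / 2 := by rw [div_le_iff₀ hσ']; linarith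
  calc n * (2 * (L / (m : ℝ) ^ α / σ) ^ 2 / m)
      = 2 * (L / σ) ^ 2 * (n / (m : ℝ) ^ (2 * α + 1)) := by field_simp; ring
    _ ≤ 2 * (1 / 2) ^ 2 * 1 := by
        gcongr
        exact (div_le_one (by positivity)).2 hn
    _ ≤ 1 := by norm_num

theorem private_lower_bound (M : Kernel (Dataset n) L2Unit) [IsMarkovKernel M] {a ε δ : ℝ}
    (hn : 0 < n) (ha : 0 < a) (hε : 0 < ε) (hε1 : ε < 1) (hδ : 0 < δ) (hδn : δ < ((n : ℝ) ^ 2)⁻¹)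
    (han : a ≤ n * ε) (hM : IsDP ε δ M) (hσ : 0 < σ)
    (hL : 0 ≤ L) (hLσ : L ≤ σ / (4 * (2 + 1 / a))) (hm : 0 < m)
    (hnm : n * ε ≤ (m : ℝ) ^ (α + 1))
    (hB : ∀ x, |iteratedDeriv α unitBump x| ≤ B) (hC : L * B ≤ C) :
    ENNReal.ofReal (L ^ 2 / 128 * ((m : ℝ) ^ (2 * α))⁻¹) ≤
      ⨆ f ∈ periodicSobolev α C, mise σ M f := by
  have hm' : (0 : ℝ) < m := by exact_mod_cast hm
  have hσ' : (0 : ℝ) < σ := by exact_mod_cast hσ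
  have hn' : (1 : ℝ) ≤ n := by exact_mod_cast hn
  have ha' : 0 < 1 / a := by positivity
  have hLσ' : L ≤ σ := hLσ.trans (div_le_self hσ'.le (by linarith))
  refine le_iSup_mise_of_vertex M hL hm hB hC (exists_vertex_le_mise_of_isDP M hε.le hδ.le hM hm
    (by positivity) hσ (amplitude_le hL hLσ' hm) ?_)
  -- The term `δ` is absorbed through `n δ ≤ 1 / n ≤ 1 ≤ n ε / a`; only here do the bounds on `δ`
  -- and on `n ε` from `a` combine.
  have h1 : n * (Real.exp ε - 1 + δ) ≤ (2 + 1 / a) * (n * ε) := by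
    have h2 : n * δ ≤ 1 := by
      calc n * δ ≤ n * ((n : ℝ) ^ 2)⁻¹ := by gcongr
        _ = (n : ℝ)⁻¹ := by field_simp
        _ ≤ 1 := inv_le_one_of_one_le₀ hn'
    have h3 : 1 ≤ 1 / a * (n * ε) := by rwa [one_div, inv_mul_eq_div, one_le_div ha]
    have h4 : n * (Real.exp ε - 1) ≤ n * (2 * ε) := by
      gcongr; exact exp_sub_one_le_two_mul hε.le hε1.le
    linarith
  have h5 : (2 + 1 / a) * (L / σ) ≤ 1 / 4 := by
    rw [le_div_iff₀ (by positivity)] at hLσ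
    rw [← mul_div_assoc, div_le_iff₀ hσ']
    linarith
  calc n * ((Real.exp ε - 1 + δ) * (2 * (L / (m : ℝ) ^ α / σ) / m))
      = n * (Real.exp ε - 1 + δ) * (2 * (L / σ) / (m : ℝ) ^ (α + 1)) := by
        field_simp
        ring
    _ ≤ (2 + 1 / a) * (n * ε) * (2 * (L / σ) / (m : ℝ) ^ (α + 1)) := by gcongr
    _ = 2 * ((2 + 1 / a) * (L / σ)) * (n * ε / (m : ℝ) ^ (α + 1)) := by ring
    _ ≤ 2 * (1 / 4) * 1 := by
        gcongr
        exact (div_le_one (by positivity)).2 hnm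
    _ ≤ 3 / 4 := by norm_num

end Rates

end PrivateRegression

theorem theorem6p1 :
    ∃ c : ℝ, 0 < c ∧
      ∀ (α : ℕ) (C : ℝ) (σ : ℝ≥0) (a : ℝ), 1 ≤ α → 0 < C → 0 < σ → 0 < a →
        ∃ c' : ℝ, 0 < c' ∧
          ∀ (n : ℕ) (ε δ : ℝ), 0 < n → 0 < ε → ε < 1 → 0 < δ → δ < c * ((n : ℝ) ^ 2)⁻¹ →
            a ≤ n * ε →
            ENNReal.ofReal
                (c' * ((n : ℝ) ^ (-(2 * (α : ℝ)) / (2 * (α : ℝ) + 1)) +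
                  ((n : ℝ) * ε) ^ (-(2 * (α : ℝ)) / ((α : ℝ) + 1)))) ≤
              PrivateRegression.minimaxRisk n α C σ ε δ := by
  -- `c = 1` suffices, since the upper bound on `δ` serves only to give `n δ ≤ 1`.
  refine ⟨1, one_pos, fun α C σ a _ hC hσ ha => ?_⟩
  obtain ⟨B, hB0, hB⟩ := PrivateRegression.exists_bound_iteratedDeriv_unitBump α
  obtain ⟨κ₁, hκ₁, H₁⟩ := PrivateRegression.exists_width (2 * α + 1) (2 * α) (by omega) one_pos
  obtain ⟨κ₂, hκ₂, H₂⟩ := PrivateRegression.exists_width (α + 1) (2 * α) (by omega) ha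
  have hσ' : (0 : ℝ) < σ := by exact_mod_cast hσ
  have ha' : 0 < 1 / a := by positivity
  -- The first bound on `L` ensures Sobolev membership, the second indistinguishability under
  -- privacy; the second also implies `L ≤ σ / 2`, which the non-private bound needs.
  set L := min (C / B) (σ / (4 * (2 + 1 / a)))
  have hL : 0 < L := by positivity
  have hLB : L * B ≤ C := (le_div_iff₀ hB0).1 (min_le_left _ _)
  have hL1 : L ≤ σ / (4 * (2 + 1 / a)) := min_le_right _ _
  have hL2 : L ≤ σ / 2 := hL1.trans (by gcongr; linarith)
  set c' := L ^ 2 / 256 * min κ₁ κ₂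
  refine ⟨c', by positivity, fun n ε δ hn hε hε1 hδ hδn han => ?_⟩
  rw [one_mul] at hδn
  refine le_iInf₂ fun M hM => ?_
  have := hM.1
  have hn' : (1 : ℝ) ≤ n := by exact_mod_cast hn
  obtain ⟨m₁, hm₁, hy₁, hr₁⟩ := H₁ n hn'
  obtain ⟨m₂, hm₂, hy₂, hr₂⟩ := H₂ (n * ε) han
  have e₁ := PrivateRegression.sample_lower_bound M hσ hL.le hL2 hm₁ hy₁ hB hLB
  have e₂ := PrivateRegression.private_lower_bound M hn ha hε hε1 hδ hδn han hM.2 hσ hL.le hL1 hm₂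
    hy₂ hB hLB
  push_cast at hr₁ hr₂
  set A₁ := (n : ℝ) ^ (-(2 * (α : ℝ)) / (2 * (α : ℝ) + 1))
  set A₂ := ((n : ℝ) * ε) ^ (-(2 * (α : ℝ)) / ((α : ℝ) + 1))
  have hA₁ : 0 < A₁ := by positivity
  have hA₂ : 0 < A₂ := by positivity
  -- The two bounds come from different hypercubes, so only the larger rate is used; it is at least
  -- half the sum, hence `256 = 2 · 128` in `c'`.
  rcases le_total A₁ A₂ with h | h
  · refine le_trans (ENNReal.ofReal_le_ofReal ?_) e₂
    calc c' * (A₁ + A₂) ≤ L ^ 2 / 256 * κ₂ * (A₂ + A₂) := by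
          simp only [c']; gcongr; exact min_le_right _ _
      _ = L ^ 2 / 128 * (κ₂ * A₂) := by ring
      _ ≤ _ := by gcongr
  · refine le_trans (ENNReal.ofReal_le_ofReal ?_) e₁
    calc c' * (A₁ + A₂) ≤ L ^ 2 / 256 * κ₁ * (A₁ + A₁) := by
          simp only [c']; gcongr; exact min_le_left _ _
      _ = L ^ 2 / 128 * (κ₁ * A₁) := by ring
      _ ≤ _ := by gcongr
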